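/- Let $G$ be a finite group and let $\mathbb F$ be a field whose characteristic does not divide $|G|$; all modules are finite-dimensional over $\mathbb F$. For a finite group $H$ of order not divisible by $\operatorname{char}\mathbb F$ and an $\mathbb FH$-module $W$, let $H$ act on the symmetric algebra $S(W)$ by the graded $\mathbb F$-algebra automorphisms extending its action on $W$, let $S(W)^H$ be the algebra of invariants, and let $S(W)^H_+$ be the ideal of $S(W)^H$ spanned by the homogeneous invariants of positive degree. For a graded vector space $X=\bigoplus_{d\ge 0}X_d$ put $\mathrm{topdeg}(X)=\sup\{d\mid X_d\ne 0\}$. For a positive integer $k$ define $$b_k(H,W)=\mathrm{topdeg}\bigl(S(W)/(S(W)^H_+)^kS(W)\bigr),\qquad \beta_k(H,W)=\mathrm{topdeg}\bigl(S(W)^H/(S(W)^H_+)^{k+1}\bigr),$$ and $\beta_k(H)=\sup\{\beta_k(H,W)\mid W \text{ is an } \mathbb FH\text{-module}\}$ (the suprema are taken in $\mathbb N\cup\{\infty\}$). **Theorem.** Let $N$ be a normal subgroup of $G$ and let $r,s$ be positive integers. For every $\mathbb F(G/N)$-module $U$ and every $\mathbb FN$-module $V$, $$b_{r+s-1}\bigl(G,\;U\oplus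 \mathrm{Ind}_N^G V\bigr)\;\ge\; b_r(G/N,U)+b_s(N,V),$$ where $U$ is regarded as an $\mathbb FG$-module on which $N$ acts trivially. In particular, $$\beta_{r+s-1}(G)\;\ge\;\beta_r(G/N)+\beta_s(N)-1 .$$ -/

import Mathlib

namespace NoetherNumbers

universe u

/-- The top degree `sup {d | X_d ≠ 0}` of a vector space `X` with homogeneous components `X_d`,
as an element of `ℕ ∪ {∞}`. -/
noncomputable def topDeg {F X : Type*} [Field F] [AddCommGroup X] [Module F X]
    (X_ : ℕ → Submodule F X) : ℕ∞ :=
  ⨆ (d : ℕ) (_ : X_ d ≠ ⊥), (d : ℕ∞)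

/-- The ideal `R_+` generated by the homogeneous components `R_d` of positive degree. -/
def positivePart {F R : Type*} [Field F] [CommRing R] [Algebra F R]
    (R_ : ℕ → Submodule F R) : Ideal R :=
  Ideal.span {x | ∃ d : ℕ, 0 < d ∧ x ∈ R_ d}

/-- The homogeneous components of the quotient `R / I`: the images of the `R_d`. -/
noncomputable def quotientGrading {F R : Type*} [Field F] [CommRing R] [Algebra F R]
    (R_ : ℕ → Submodule F R) (I : Ideal R) (d : ℕ) : Submodule F (R ⧸ I) :=
  (R_ d).map (Ideal.Quotient.mkₐ F I).toLinearMap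

section

variable {F : Type*} [Field F] {G : Type*} [Group G]
  {W : Type*} [AddCommGroup W] [Module F W]

variable (F W) in
/-- The homogeneous component `S(W)_d`: the span of the products of `d` elements of
`W = S(W)_1`. -/
noncomputable def symGrading (d : ℕ) : Submodule F (SymmetricAlgebra F W) :=
  LinearMap.range (SymmetricAlgebra.ι F W) ^ d

/-- The action of `g` on `S(W)`: the algebra endomorphism which extends the action of `g`
on `W`. -/
noncomputable def symAction (ρ : Representation F G W) (g : G) :
    SymmetricAlgebra F W →ₐ[F] SymmetricAlgebra F W :=
  SymmetricAlgebra.lift (SymmetricAlgebra.ι F W ∘ₗ ρ g)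

/-- The algebra of invariants `S(W)^G`. -/
noncomputable def invariants (ρ : Representation F G W) :
    Subalgebra F (SymmetricAlgebra F W) where
  carrier := {f | ∀ g : G, symAction ρ g f = f}
  mul_mem' ha hb g := by rw [map_mul, ha g, hb g]
  add_mem' ha hb g := by rw [map_add, ha g, hb g]
  algebraMap_mem' c g := AlgHom.commutes _ c

/-- The homogeneous component `S(W)^G_d = S(W)^G ∩ S(W)_d` of the algebra of invariants. -/
noncomputable def invariantsGrading (ρ : Representation F G W) (d : ℕ) :
    Submodule F (invariants ρ) :=
  (symGrading F W d).comap (invariants ρ).val.toLinearMap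

/-- The ideal `S(W)^G_+` of `S(W)^G`. -/
noncomputable def invariantsPos (ρ : Representation F G W) : Ideal (invariants ρ) :=
  positivePart (invariantsGrading ρ)

/-- `β_k(G, W)`, the top degree of `S(W)^G / (S(W)^G_+)^(k+1)`. -/
noncomputable def betaRep (k : ℕ) (ρ : Representation F G W) : ℕ∞ :=
  topDeg (quotientGrading (invariantsGrading ρ) (invariantsPos ρ ^ (k + 1)))

/-- `b_k(G, W)`, the top degree of `S(W) / (S(W)^G_+)^k S(W)`. -/
noncomputable def bRep (k : ℕ) (ρ : Representation F G W) : ℕ∞ :=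
  topDeg (quotientGrading (symGrading F W)
    ((invariantsPos ρ ^ k).map (invariants ρ).val.toRingHom))

/-- The representation `U ⊕ Ind_N^G V` of `G`, where `N` acts trivially on `U`. -/
noncomputable def inflSumInd (N : Subgroup G) [N.Normal]
    {U : Type*} [AddCommGroup U] [Module F U] {V : Type*} [AddCommGroup V] [Module F V]
    (ρU : Representation F (G ⧸ N) U) (ρV : Representation F N V) :
    Representation F G (U × Representation.IndV N.subtype ρV) :=
  Representation.prod (ρU.comp (QuotientGroup.mk' N)) (Representation.ind N.subtype ρV)

end

/-- The `k`-th Noether number `β_k(G)` over `F`: the supremum of `β_k(G, W)` over all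
finite-dimensional `F G`-modules `W`. (Every such module is isomorphic to one whose underlying
type lives in the universe of `F`.) -/
noncomputable def noetherNumber (k : ℕ) (F : Type u) [Field F] (G : Type*) [Group G] : ℕ∞ :=
  ⨆ (W : Type u) (_ : AddCommGroup W) (_ : Module F W) (_ : FiniteDimensional F W)
    (ρ : Representation F G W), betaRep k ρ

end NoetherNumbers

namespace NoetherNumbers

open SymmetricAlgebra TensorProduct

/-! Write `I_U`, `I_V` for the ideals of `S(U)`, `S(V)` generated by the positive degree invariants
of `G/N` and `N`. Projecting `Ind_N^G V` onto its summand `V` gives `S(U ⊕ Ind V) → S(U) ⊗ S(V)`. A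
positive degree `G`-invariant has an image fixed by `N`, which acts on `S(V)` only; averaging over
`N` shows that modulo `I_V` the image equals its component in `S(U)`, and this component is
`G/N`-invariant. So positive degree invariants land in `I_U ⊗ S(V) + S(U) ⊗ I_V`
(`symProj_sub_mem`). If `f ∉ I_U^r` and `h ∉ I_V^s`, then `f ⊗ h` avoids the power `r + s - 1` of
that ideal (`tmul_notMem_sup_pow`), which gives the inequality for `b`.

The inequality for `β` follows by comparing the two invariants: `β_k(W) ≤ b_k(W) + 1` by the
Reynolds operator (`betaRep_le_bRep_add_one`), and `b_k(W) + 1 ≤ β_k(W ⊕ FG)` by polarization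
(`bRep_add_one_le_betaRep_sumRegular`). The first is used twice and the second once, hence the
defect of one. -/

theorem sup_pow_eq_bot {R : Type*} [CommRing R] {I J : Ideal R} {r s : ℕ}
    (hI : I ^ r = ⊥) (hJ : J ^ s = ⊥) : (I ⊔ J) ^ (r + s - 1) = ⊥ := by
  rw [← Submodule.add_eq_sup, add_pow, ← Ideal.zero_eq_bot]
  refine Finset.sum_eq_zero fun m _ => ?_
  -- Pigeonhole: in each binomial term either the exponent of `I` is at least `r` or that of `J` is
  -- at least `s`.
  rcases le_or_gt r m with h | h
  · rw [← Nat.sub_add_cancel h, pow_add, hI]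
    simp
  · have h' : s ≤ r + s - 1 - m := by omega
    rw [← Nat.sub_add_cancel h', pow_add, hJ]
    simp

theorem le_topDeg {F X : Type*} [Field F] [AddCommGroup X] [Module F X]
    {X_ : ℕ → Submodule F X} {d : ℕ} (h : X_ d ≠ ⊥) : (d : ℕ∞) ≤ topDeg X_ :=
  le_iSup₂ (f := fun (d : ℕ) (_ : X_ d ≠ ⊥) => (d : ℕ∞)) d h

theorem quotientGrading_ne_bot_iff {F R : Type*} [Field F] [CommRing R] [Algebra F R]
    {R_ : ℕ → Submodule F R} {I : Ideal R} {d : ℕ} :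
    quotientGrading R_ I d ≠ ⊥ ↔ ∃ x ∈ R_ d, x ∉ I := by
  rw [quotientGrading, Submodule.ne_bot_iff]
  constructor
  · rintro ⟨_, ⟨x, hx, rfl⟩, h⟩
    exact ⟨x, hx, fun hI => h (Ideal.Quotient.eq_zero_iff_mem.2 hI)⟩
  · rintro ⟨x, hx, h⟩
    exact ⟨_, ⟨x, hx, rfl⟩, fun hI => h (Ideal.Quotient.eq_zero_iff_mem.1 hI)⟩

/-! ### Functoriality and grading of the symmetric algebra -/

section Functoriality

variable {F : Type*} [Field F] {G : Type*} [Group G]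
  {W : Type*} [AddCommGroup W] [Module F W]
  {W' : Type*} [AddCommGroup W'] [Module F W']
  {W'' : Type*} [AddCommGroup W''] [Module F W'']

/-- The algebra homomorphism `S(W) → S(W')` induced by a linear map `W → W'`. -/
noncomputable def symMap (T : W →ₗ[F] W') :
    SymmetricAlgebra F W →ₐ[F] SymmetricAlgebra F W' :=
  lift (ι F W' ∘ₗ T)

@[simp]
theorem symMap_ι (T : W →ₗ[F] W') (w : W) : symMap T (ι F W w) = ι F W' (T w) :=
  lift_ι_apply _ _

theorem symMap_symMap (T' : W' →ₗ[F] W'') (T : W →ₗ[F] W') (x : SymmetricAlgebra F W) :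
    symMap T' (symMap T x) = symMap (T' ∘ₗ T) x := by
  have : (symMap T').comp (symMap T) = symMap (T' ∘ₗ T) := by
    ext w
    simp
  exact DFunLike.congr_fun this x

theorem symMap_id (x : SymmetricAlgebra F W) : symMap (LinearMap.id : W →ₗ[F] W) x = x := by
  have : symMap (LinearMap.id : W →ₗ[F] W) = AlgHom.id F _ := by
    ext w
    simp
  exact DFunLike.congr_fun this x

theorem symMap_mem_symGrading (T : W →ₗ[F] W') {d : ℕ} {x : SymmetricAlgebra F W}
    (hx : x ∈ symGrading F W d) : symMap T x ∈ symGrading F W' d := by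
  have h : (symGrading F W d).map (symMap T).toLinearMap ≤ symGrading F W' d := by
    rw [symGrading, symGrading, Submodule.map_pow]
    refine pow_le_pow_left' ?_ d
    rintro _ ⟨_, ⟨w, rfl⟩, rfl⟩
    exact ⟨T w, (symMap_ι T w).symm⟩
  exact h ⟨x, hx, rfl⟩

theorem symAction_eq (ρ : Representation F G W) (g : G) : symAction ρ g = symMap (ρ g) :=
  rfl

theorem symAction_mul (ρ : Representation F G W) (g h : G) (x : SymmetricAlgebra F W) :
    symAction ρ (g * h) x = symAction ρ g (symAction ρ h x) := by
  rw [symAction_eq, symAction_eq, symAction_eq, symMap_symMap, map_mul]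
  rfl

theorem symMap_symAction {ρ : Representation F G W} {ρ' : Representation F G W'}
    {T : W →ₗ[F] W'} {g : G} (hT : ∀ w, T (ρ g w) = ρ' g (T w)) (x : SymmetricAlgebra F W) :
    symMap T (symAction ρ g x) = symAction ρ' g (symMap T x) := by
  rw [symAction_eq, symAction_eq, symMap_symMap, symMap_symMap]
  congr 2
  exact LinearMap.ext hT

theorem ι_mem_symGrading (w : W) : ι F W w ∈ symGrading F W 1 := by
  rw [symGrading, pow_one]
  exact ⟨w, rfl⟩

theorem mul_mem_symGrading {d e : ℕ} {x y : SymmetricAlgebra F W}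
    (hx : x ∈ symGrading F W d) (hy : y ∈ symGrading F W e) :
    x * y ∈ symGrading F W (d + e) := by
  rw [symGrading, pow_add]
  exact Submodule.mul_mem_mul hx hy

theorem algebraMap_mem_symGrading (c : F) :
    algebraMap F (SymmetricAlgebra F W) c ∈ symGrading F W 0 := by
  rw [symGrading, pow_zero]
  exact Submodule.algebraMap_mem c

theorem iSup_symGrading : ⨆ d, symGrading F W d = ⊤ := by
  refine Submodule.eq_top_iff'.2 fun x => ?_
  induction x using SymmetricAlgebra.induction with
  | algebraMap c => exact Submodule.mem_iSup_of_mem 0 (algebraMap_mem_symGrading c)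
  | ι w => exact Submodule.mem_iSup_of_mem 1 (ι_mem_symGrading w)
  | add x y hx hy => exact add_mem hx hy
  | mul x y hx hy =>
    have h : (⨆ d, symGrading F W d) * (⨆ d, symGrading F W d) ≤ ⨆ d, symGrading F W d := by
      simp only [Submodule.iSup_mul, Submodule.mul_iSup]
      refine iSup₂_le fun d e => ?_
      rw [symGrading, symGrading, ← pow_add]
      exact le_iSup (symGrading F W) _
    exact h (Submodule.mul_mem_mul hx hy)

theorem algebraMapInv_eq_zero {d : ℕ} (hd : 0 < d) {x : SymmetricAlgebra F W}
    (hx : x ∈ symGrading F W d) : algebraMapInv (R := F) x = 0 := by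
  have h : (symGrading F W d).map (algebraMapInv (R := F) (M := W)).toLinearMap ≤ ⊥ := by
    rw [symGrading, Submodule.map_pow]
    have h0 : (LinearMap.range (ι F W)).map
        (algebraMapInv (R := F) (M := W)).toLinearMap = ⊥ := by
      rw [eq_bot_iff]
      rintro _ ⟨_, ⟨w, rfl⟩, rfl⟩
      exact algebraMapInv_ι w
    rw [h0, Submodule.bot_pow hd.ne']
  exact h ⟨x, hx, rfl⟩

end Functoriality

/-! ### The ideal generated by positive degree invariants, and its powers -/

section Invariants

variable {F : Type*} [Field F] {G : Type*} [Group G]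
  {W : Type*} [AddCommGroup W] [Module F W]

/-- The ideal of `S(W)` generated by the homogeneous invariants of positive degree. -/
noncomputable def hilbertIdeal (ρ : Representation F G W) : Ideal (SymmetricAlgebra F W) :=
  (invariantsPos ρ).map (invariants ρ).val.toRingHom

theorem map_invariantsPos_pow (ρ : Representation F G W) (k : ℕ) :
    (invariantsPos ρ ^ k).map (invariants ρ).val.toRingHom = hilbertIdeal ρ ^ k :=
  Ideal.map_pow _ _ _

theorem mem_invariantsPos {ρ : Representation F G W} {d : ℕ} (hd : 0 < d)
    {x : invariants ρ} (hx : (x : SymmetricAlgebra F W) ∈ symGrading F W d) :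
    x ∈ invariantsPos ρ :=
  Ideal.subset_span ⟨d, hd, hx⟩

theorem mem_hilbertIdeal {ρ : Representation F G W} {d : ℕ} (hd : 0 < d)
    {x : SymmetricAlgebra F W} (hx : x ∈ symGrading F W d) (hinv : ∀ g, symAction ρ g x = x) :
    x ∈ hilbertIdeal ρ :=
  Ideal.mem_map_of_mem (invariants ρ).val.toRingHom
    (mem_invariantsPos (x := ⟨x, hinv⟩) hd hx)

theorem map_hilbertIdeal_le {ρ : Representation F G W} {A : Type*} [CommRing A] [Algebra F A]
    (φ : SymmetricAlgebra F W →ₐ[F] A) {K : Ideal A}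
    (h : ∀ d, 0 < d → ∀ x ∈ symGrading F W d, (∀ g, symAction ρ g x = x) → φ x ∈ K) :
    (hilbertIdeal ρ).map φ.toRingHom ≤ K := by
  rw [hilbertIdeal, invariantsPos, positivePart, Ideal.map_span, Ideal.map_span, Ideal.span_le]
  rintro _ ⟨_, ⟨x, ⟨d, hd, hx⟩, rfl⟩, rfl⟩
  exact h d hd x hx x.2

/-- A test for non-membership: it suffices to find a homomorphism sending positive degree invariants
into a nilpotent ideal of exponent `k` and not killing `y`. -/
theorem eq_zero_of_mem_hilbertIdeal_pow {ρ : Representation F G W} {A : Type*} [CommRing A]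
    [Algebra F A] (φ : SymmetricAlgebra F W →ₐ[F] A) {K : Ideal A} {k : ℕ} (hK : K ^ k = ⊥)
    (h : ∀ d, 0 < d → ∀ x ∈ symGrading F W d, (∀ g, symAction ρ g x = x) → φ x ∈ K)
    {y : SymmetricAlgebra F W} (hy : y ∈ hilbertIdeal ρ ^ k) : φ y = 0 := by
  have h1 : φ y ∈ (hilbertIdeal ρ ^ k).map φ.toRingHom := Ideal.mem_map_of_mem φ.toRingHom hy
  rw [Ideal.map_pow] at h1
  have h2 := Ideal.pow_right_mono (map_hilbertIdeal_le φ h) k h1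
  rwa [hK] at h2

theorem one_notMem_hilbertIdeal_pow (ρ : Representation F G W) {k : ℕ} (hk : 0 < k) :
    (1 : SymmetricAlgebra F W) ∉ hilbertIdeal ρ ^ k := by
  intro h
  have := eq_zero_of_mem_hilbertIdeal_pow (algebraMapInv (R := F) (M := W)) (K := ⊥)
    (zero_pow hk.ne') (fun d hd x hx _ => algebraMapInv_eq_zero hd hx) h
  simp at this

/-- Distributing addition over a supremum in `ℕ∞` requires a nonempty index set; degree `0` supplies
an index because `k > 0`. -/
theorem exists_quotientGrading_ne_bot (ρ : Representation F G W) {k : ℕ} (hk : 0 < k) :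
    ∃ d, quotientGrading (symGrading F W)
      ((invariantsPos ρ ^ k).map (invariants ρ).val.toRingHom) d ≠ ⊥ := by
  refine ⟨0, quotientGrading_ne_bot_iff.2 ⟨1, ?_, ?_⟩⟩
  · simpa using algebraMap_mem_symGrading (W := W) (1 : F)
  · rw [map_invariantsPos_pow]
    exact one_notMem_hilbertIdeal_pow ρ hk

theorem le_bRep {ρ : Representation F G W} {k d : ℕ} {x : SymmetricAlgebra F W}
    (hx : x ∈ symGrading F W d) (h : x ∉ hilbertIdeal ρ ^ k) : (d : ℕ∞) ≤ bRep k ρ :=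
  le_topDeg (quotientGrading_ne_bot_iff.2 ⟨x, hx, by rwa [map_invariantsPos_pow]⟩)

theorem le_betaRep {ρ : Representation F G W} {k d : ℕ} {x : invariants ρ}
    (hx : (x : SymmetricAlgebra F W) ∈ symGrading F W d) (h : x ∉ invariantsPos ρ ^ (k + 1)) :
    (d : ℕ∞) ≤ betaRep k ρ :=
  le_topDeg (quotientGrading_ne_bot_iff.2 ⟨x, hx, h⟩)

/-! ### The Reynolds operator and the bound `β_k ≤ b_k + 1` -/

section Reynolds

variable [Fintype G] (ρ : Representation F G W)

/-- The Reynolds operator on `S(W)`. -/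
noncomputable def reynolds : SymmetricAlgebra F W →ₗ[F] SymmetricAlgebra F W :=
  (Fintype.card G : F)⁻¹ • ∑ g, (symAction ρ g).toLinearMap

theorem reynolds_apply (x : SymmetricAlgebra F W) :
    reynolds ρ x = (Fintype.card G : F)⁻¹ • ∑ g, symAction ρ g x := by
  simp [reynolds]

theorem symAction_reynolds (g : G) (x : SymmetricAlgebra F W) :
    symAction ρ g (reynolds ρ x) = reynolds ρ x := by
  rw [reynolds_apply, map_smul, map_sum]
  congr 1
  exact Fintype.sum_equiv (Equiv.mulLeft g) _ _ fun h => (symAction_mul ρ g h x).symm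

theorem reynolds_mul {x : SymmetricAlgebra F W} (hx : ∀ g, symAction ρ g x = x)
    (y : SymmetricAlgebra F W) : reynolds ρ (x * y) = x * reynolds ρ y := by
  simp [reynolds_apply, hx, Finset.mul_sum]

theorem reynolds_mem_symGrading {d : ℕ} {x : SymmetricAlgebra F W}
    (hx : x ∈ symGrading F W d) : reynolds ρ x ∈ symGrading F W d := by
  rw [reynolds_apply]
  exact Submodule.smul_mem _ _ (sum_mem fun g _ => symMap_mem_symGrading (ρ g) hx)

variable (hG : (Fintype.card G : F) ≠ 0)
include hG

theorem reynolds_eq_self {x : SymmetricAlgebra F W} (hx : ∀ g, symAction ρ g x = x) :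
    reynolds ρ x = x := by
  simp [reynolds_apply, hx, ← Nat.cast_smul_eq_nsmul F, smul_smul, hG]

/-- The claim is linear in `x`, so homogeneous `x` suffice: constants are fixed by averaging, and in
positive degree the constant term vanishes. -/
theorem exists_mem_invariantsPos_reynolds (x : SymmetricAlgebra F W) :
    ∃ y ∈ invariantsPos ρ, (y : SymmetricAlgebra F W) =
      reynolds ρ x - algebraMap F _ (algebraMapInv (R := F) x) := by
  have hx : x ∈ ⨆ d, symGrading F W d := iSup_symGrading (F := F) (W := W) ▸ Submodule.mem_top
  induction hx using Submodule.iSup_induction' with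
  | mem d x hx =>
    rcases Nat.eq_zero_or_pos d with rfl | hd
    · rw [symGrading, pow_zero] at hx
      obtain ⟨c, rfl⟩ := Submodule.mem_one.1 hx
      refine ⟨0, zero_mem _, ?_⟩
      rw [reynolds_eq_self ρ hG fun g => AlgHom.commutes _ c, algebraMap_leftInverse W c]
      simp
    · refine ⟨⟨reynolds ρ x, fun g => symAction_reynolds ρ g x⟩,
        mem_invariantsPos hd (reynolds_mem_symGrading ρ hx), ?_⟩
      simp [algebraMapInv_eq_zero hd hx]
  | zero => exact ⟨0, zero_mem _, by simp⟩
  | add x y _ _ hx hy =>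
    obtain ⟨a, ha, ha'⟩ := hx
    obtain ⟨b, hb, hb'⟩ := hy
    refine ⟨a + b, add_mem ha hb, ?_⟩
    rw [Subalgebra.coe_add, ha', hb']
    simp only [map_add]
    abel

theorem reynolds_sub_mem_hilbertIdeal (x : SymmetricAlgebra F W) :
    reynolds ρ x - algebraMap F _ (algebraMapInv (R := F) x) ∈ hilbertIdeal ρ := by
  obtain ⟨y, hy, h⟩ := exists_mem_invariantsPos_reynolds ρ hG x
  rw [← h]
  exact Ideal.mem_map_of_mem (invariants ρ).val.toRingHom hy

/-- Averaging is linear over invariants, so the extra factor `w` without constant term contributes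
one more power. Quantifying over all `w` lets the induction absorb the coefficients of `x` into `w`.
-/
theorem exists_mem_invariantsPos_pow_reynolds {k : ℕ} {x : SymmetricAlgebra F W}
    (hx : x ∈ hilbertIdeal ρ ^ k) :
    ∀ w : SymmetricAlgebra F W, algebraMapInv (R := F) w = 0 →
      ∃ y ∈ invariantsPos ρ ^ (k + 1), (y : SymmetricAlgebra F W) = reynolds ρ (x * w) := by
  rw [← map_invariantsPos_pow, Ideal.map] at hx
  induction hx using Submodule.span_induction with
  | mem x hx =>
    intro w hw
    obtain ⟨x, hx, rfl⟩ := hx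
    obtain ⟨y, hy, h⟩ := exists_mem_invariantsPos_reynolds ρ hG w
    rw [hw, map_zero, sub_zero] at h
    refine ⟨x * y, pow_succ (invariantsPos ρ) k ▸ Ideal.mul_mem_mul hx hy, ?_⟩
    rw [Subalgebra.coe_mul, h]
    exact (reynolds_mul ρ x.2 w).symm
  | zero => exact fun w _ => ⟨0, zero_mem _, by simp⟩
  | add x x' _ _ hx hx' =>
    intro w hw
    obtain ⟨a, ha, ha'⟩ := hx w hw
    obtain ⟨b, hb, hb'⟩ := hx' w hw
    exact ⟨a + b, add_mem ha hb, by rw [Subalgebra.coe_add, ha', hb', add_mul, map_add]⟩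
  | smul a x _ hx =>
    intro w hw
    obtain ⟨y, hy, h⟩ := hx (a * w) (by rw [map_mul, hw, mul_zero])
    exact ⟨y, hy, by rw [h, smul_eq_mul]; congr 1; ring⟩

theorem betaRep_le_bRep_add_one (k : ℕ) : betaRep k ρ ≤ bRep k ρ + 1 := by
  refine iSup₂_le fun d hd => ?_
  obtain ⟨f, hf, hfI⟩ := quotientGrading_ne_bot_iff.1 hd
  -- Degree `0` is harmless. In degree `e + 1`, if all of `S(W)_e` lay in the `k`-th power, then
  -- `f`, a sum of products from `S(W)_e · W` and its own average, would lie in the power `k + 1`.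
  rcases d with _ | e
  · simp
  rw [Nat.cast_succ]
  gcongr
  suffices ∃ x ∈ symGrading F W e, x ∉ hilbertIdeal ρ ^ k by
    obtain ⟨x, hx, hxI⟩ := this
    exact le_bRep hx hxI
  by_contra! h
  have hf' : (f : SymmetricAlgebra F W) ∈ symGrading F W e * LinearMap.range (ι F W) := by
    rw [symGrading, ← pow_succ]
    exact hf
  have key : ∀ x ∈ symGrading F W e * LinearMap.range (ι F W),
      ∃ y ∈ invariantsPos ρ ^ (k + 1), (y : SymmetricAlgebra F W) = reynolds ρ x := by
    intro x hx
    induction hx using Submodule.mul_induction_on' with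
    | mem_mul_mem x hx w hw =>
      obtain ⟨w, rfl⟩ := hw
      exact exists_mem_invariantsPos_pow_reynolds ρ hG (h x hx) _ (algebraMapInv_ι w)
    | add x _ y _ hx hy =>
      obtain ⟨a, ha, ha'⟩ := hx
      obtain ⟨b, hb, hb'⟩ := hy
      exact ⟨a + b, add_mem ha hb, by rw [Subalgebra.coe_add, ha', hb', map_add]⟩
  obtain ⟨y, hy, hyf⟩ := key f hf'
  rw [reynolds_eq_self ρ hG f.2] at hyf
  exact hfI (Subtype.ext hyf ▸ hy)

end Reynolds

end Invariants

end NoetherNumbers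

namespace NoetherNumbers

open SymmetricAlgebra TensorProduct

/-! ### Powers of a sum of ideals in a tensor product -/

section TensorProduct

variable {F : Type*} [Field F]

theorem tmul_ne_zero_of_ne_zero {A B : Type*} [AddCommGroup A] [Module F A] [AddCommGroup B]
    [Module F B] {a : A} {b : B} (ha : a ≠ 0) (hb : b ≠ 0) : (a ⊗ₜ[F] b) ≠ 0 := by
  intro h
  obtain ⟨f, hf⟩ := not_forall.1 (mt (Module.forall_dual_apply_eq_zero_iff F a).1 ha)
  obtain ⟨g, hg⟩ := not_forall.1 (mt (Module.forall_dual_apply_eq_zero_iff F b).1 hb)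
  have := congrArg (LinearMap.mul' F F ∘ₗ TensorProduct.map f g) h
  rw [map_zero] at this
  exact mul_ne_zero hf hg this

/-- In `A/I^r ⊗ B/J^s` the extended ideals have vanishing `r`-th and `s`-th powers, so the power `r
+ s - 1` of their sum is zero, while `a ⊗ b` survives because `F` is a field. -/
theorem tmul_notMem_sup_pow {A B : Type*} [CommRing A] [Algebra F A] [CommRing B] [Algebra F B]
    {I : Ideal A} {J : Ideal B} {r s : ℕ} {a : A} {b : B} (ha : a ∉ I ^ r) (hb : b ∉ J ^ s) :
    a ⊗ₜ[F] b ∉ (I.map (Algebra.TensorProduct.includeLeft : A →ₐ[F] A ⊗[F] B).toRingHom ⊔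
      J.map (Algebra.TensorProduct.includeRight : B →ₐ[F] A ⊗[F] B).toRingHom) ^ (r + s - 1) := by
  intro h
  let q := Algebra.TensorProduct.map (Ideal.Quotient.mkₐ F (I ^ r)) (Ideal.Quotient.mkₐ F (J ^ s))
  have hq := Ideal.mem_map_of_mem q.toRingHom h
  rw [Ideal.map_pow, Ideal.map_sup, sup_pow_eq_bot] at hq
  · exact tmul_ne_zero_of_ne_zero (fun h0 => ha (Ideal.Quotient.eq_zero_iff_mem.1 h0))
      (fun h0 => hb (Ideal.Quotient.eq_zero_iff_mem.1 h0)) hq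
  · rw [← Ideal.map_pow, ← Ideal.map_pow, Ideal.map_map, Ideal.map_eq_bot_iff_le_ker]
    intro y hy
    have hy' : Ideal.Quotient.mkₐ F (I ^ r) y = 0 := Ideal.Quotient.eq_zero_iff_mem.2 hy
    change q (y ⊗ₜ 1) = 0
    rw [Algebra.TensorProduct.map_tmul, hy', zero_tmul]
  · rw [← Ideal.map_pow, ← Ideal.map_pow, Ideal.map_map, Ideal.map_eq_bot_iff_le_ker]
    intro y hy
    have hy' : Ideal.Quotient.mkₐ F (J ^ s) y = 0 := Ideal.Quotient.eq_zero_iff_mem.2 hy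
    change q (1 ⊗ₜ y) = 0
    rw [Algebra.TensorProduct.map_tmul, hy', tmul_zero]

end TensorProduct

/-! ### The projection to `S(U) ⊗ S(V)` and the inequality for `b` -/

section NormalSubgroup

variable {F : Type*} [Field F] {G : Type*} [Group G]

/-- The projection of `Ind_H^G V` onto its `H`-summand `V`. -/
noncomputable def indProj (H : Subgroup G) {V : Type*} [AddCommGroup V] [Module F V]
    (ρ : Representation F H V) : Representation.IndV H.subtype ρ →ₗ[F] V :=
  open Classical in
  -- In the coinvariants, `g ⊗ v` with `g ∈ H` has the same class as `1 ⊗ g⁻¹ v`; this dictates the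
  -- inverse. All cosets other than `H` are sent to zero.
  Representation.Coinvariants.lift _
    (TensorProduct.lift
      ((Finsupp.lsum F fun g : G =>
        LinearMap.toSpanSingleton F (V →ₗ[F] V)
          (if h : g ∈ H then ρ (⟨g, h⟩⁻¹ : H) else 0)) ∘ₗ
        (MonoidAlgebra.coeffLinearEquiv F).toLinearMap))
    (by
      intro n
      ext g v
      by_cases h : g ∈ H
      · have h' : (n : G) * g ∈ H := mul_mem n.2 h
        simp only [TensorProduct.AlgebraTensorModule.curry_apply, LinearMap.restrictScalars_self,
          TensorProduct.curry_apply, LinearMap.comp_apply, MonoidAlgebra.lsingle_apply]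
        simp [h, h', ← Module.End.mul_apply, ← map_mul]
        congr 3
        ext
        simp
      · have h' : (n : G) * g ∉ H := fun hn => h ((Subgroup.mul_mem_cancel_left H n.2).1 hn)
        simp [h, h'])

open Classical in
theorem indProj_mk (H : Subgroup G) {V : Type*} [AddCommGroup V] [Module F V]
    (ρ : Representation F H V) (g : G) (v : V) :
    indProj H ρ (Representation.IndV.mk H.subtype ρ g v) =
      if h : g ∈ H then ρ (⟨g, h⟩⁻¹ : H) v else 0 := by
  split_ifs with h <;> simp [indProj, h]

theorem indProj_mk_one (H : Subgroup G) {V : Type*} [AddCommGroup V] [Module F V]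
    (ρ : Representation F H V) (v : V) :
    indProj H ρ (Representation.IndV.mk H.subtype ρ 1 v) = v := by
  have h : (⟨1, one_mem H⟩ : H) = 1 := rfl
  rw [indProj_mk, dif_pos (one_mem H), h, inv_one, map_one, Module.End.one_apply]

theorem indProj_ind (H : Subgroup G) {V : Type*} [AddCommGroup V] [Module F V]
    (ρ : Representation F H V) (n : H) (w : Representation.IndV H.subtype ρ) :
    indProj H ρ (Representation.ind H.subtype ρ n w) = ρ n (indProj H ρ w) := by
  suffices indProj H ρ ∘ₗ Representation.ind H.subtype ρ n = ρ n ∘ₗ indProj H ρ from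
    DFunLike.congr_fun this w
  refine Representation.IndV.hom_ext _ _ fun g => LinearMap.ext fun v => ?_
  simp only [LinearMap.comp_apply]
  change indProj H ρ (Representation.ind H.subtype ρ n (Representation.IndV.mk H.subtype ρ g v)) =
    ρ n (indProj H ρ (Representation.IndV.mk H.subtype ρ g v))
  rw [Representation.ind_mk, indProj_mk, indProj_mk]
  by_cases h : g ∈ H
  · have h' : g * (n : G)⁻¹ ∈ H := mul_mem h (inv_mem n.2)
    rw [dif_pos h, dif_pos h', ← Module.End.mul_apply, ← map_mul]
    congr 2
    ext
    simp
  · have h' : g * (n : G)⁻¹ ∉ H := fun hn =>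
      h ((Subgroup.mul_mem_cancel_right H (inv_mem n.2)).1 hn)
    rw [dif_neg h, dif_neg h', map_zero]

variable (N : Subgroup G) {U : Type*} [AddCommGroup U] [Module F U]
  {V : Type*} [AddCommGroup V] [Module F V]
  (ρV : Representation F N V)

/-- The algebra homomorphism `S(U ⊕ Ind_N^G V) → S(U) ⊗ S(V)` induced by the projection of
`U ⊕ Ind_N^G V` onto `U ⊕ V`. -/
noncomputable def symProj : SymmetricAlgebra F (U × Representation.IndV N.subtype ρV) →ₐ[F]
    SymmetricAlgebra F U ⊗[F] SymmetricAlgebra F V :=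
  SymmetricAlgebra.lift
    (Algebra.TensorProduct.includeLeft.toLinearMap ∘ₗ ι F U ∘ₗ LinearMap.fst F _ _ +
      Algebra.TensorProduct.includeRight.toLinearMap ∘ₗ ι F V ∘ₗ indProj N ρV ∘ₗ
        LinearMap.snd F _ _)

theorem symProj_ι (w : U × Representation.IndV N.subtype ρV) :
    symProj N ρV (ι F _ w) = ι F U w.1 ⊗ₜ 1 + 1 ⊗ₜ ι F V (indProj N ρV w.2) := by
  simp [symProj]

theorem symProj_symMap_inl (x : SymmetricAlgebra F U) :
    symProj N ρV (symMap (LinearMap.inl F U (Representation.IndV N.subtype ρV)) x) = x ⊗ₜ 1 := by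
  suffices (symProj N ρV).comp (symMap (LinearMap.inl F U (Representation.IndV N.subtype ρV))) =
    Algebra.TensorProduct.includeLeft from DFunLike.congr_fun this x
  refine SymmetricAlgebra.algHom_ext (LinearMap.ext fun u => ?_)
  change symProj N ρV (symMap (LinearMap.inl F U (Representation.IndV N.subtype ρV)) (ι F U u)) = ι F U u ⊗ₜ 1
  rw [symMap_ι, symProj_ι, LinearMap.inl_apply, map_zero, map_zero, tmul_zero, add_zero]

theorem symProj_symMap_inr (x : SymmetricAlgebra F V) :
    symProj N ρV (symMap (LinearMap.inr F U (Representation.IndV N.subtype ρV) ∘ₗ Representation.IndV.mk N.subtype ρV 1) x) =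
      1 ⊗ₜ x := by
  suffices (symProj N ρV).comp (symMap (LinearMap.inr F U (Representation.IndV N.subtype ρV) ∘ₗ
      Representation.IndV.mk N.subtype ρV 1)) =
    Algebra.TensorProduct.includeRight from DFunLike.congr_fun this x
  refine SymmetricAlgebra.algHom_ext (LinearMap.ext fun v => ?_)
  change symProj N ρV (symMap (LinearMap.inr F U (Representation.IndV N.subtype ρV) ∘ₗ Representation.IndV.mk N.subtype ρV 1)
    (ι F V v)) = 1 ⊗ₜ ι F V v
  rw [symMap_ι, symProj_ι, LinearMap.comp_apply, LinearMap.inr_apply, map_zero, zero_tmul,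
    zero_add, indProj_mk_one]

/-- Taking the constant term in `S(V)` after the projection amounts to discarding `Ind_N^G V`
altogether. Both sides are algebra homomorphisms, so generators suffice. -/
theorem map_algebraMapInv_symProj
    (x : SymmetricAlgebra F (U × Representation.IndV N.subtype ρV)) :
    Algebra.TensorProduct.map (AlgHom.id F (SymmetricAlgebra F U))
        ((Algebra.ofId F (SymmetricAlgebra F V)).comp algebraMapInv) (symProj N ρV x) =
      symMap (LinearMap.fst F U (Representation.IndV N.subtype ρV)) x ⊗ₜ 1 := by
  suffices (Algebra.TensorProduct.map (AlgHom.id F (SymmetricAlgebra F U))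
        ((Algebra.ofId F (SymmetricAlgebra F V)).comp algebraMapInv)).comp (symProj N ρV) =
      Algebra.TensorProduct.includeLeft.comp (symMap (LinearMap.fst F U (Representation.IndV N.subtype ρV))) from
    DFunLike.congr_fun this x
  refine SymmetricAlgebra.algHom_ext (LinearMap.ext fun w => ?_)
  change Algebra.TensorProduct.map (AlgHom.id F (SymmetricAlgebra F U))
        ((Algebra.ofId F (SymmetricAlgebra F V)).comp algebraMapInv) (symProj N ρV (ι F _ w)) =
      symMap (LinearMap.fst F U (Representation.IndV N.subtype ρV)) (ι F _ w) ⊗ₜ 1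
  rw [symProj_ι]
  simp [algebraMapInv_ι]

variable [N.Normal] (ρU : Representation F (G ⧸ N) U)

/-- `N` is trivial on `U`, and the projection of `Ind_N^G V` onto `V` is `N`-equivariant, so `n`
moves the second factor only. -/
theorem symProj_symAction (n : N)
    (x : SymmetricAlgebra F (U × Representation.IndV N.subtype ρV)) :
    symProj N ρV (symAction (inflSumInd N ρU ρV) n x) =
      Algebra.TensorProduct.map (AlgHom.id F _) (symAction ρV n) (symProj N ρV x) := by
  suffices (symProj N ρV).comp (symAction (inflSumInd N ρU ρV) n) =
    (Algebra.TensorProduct.map (AlgHom.id F _) (symAction ρV n)).comp (symProj N ρV) from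
      DFunLike.congr_fun this x
  refine SymmetricAlgebra.algHom_ext (LinearMap.ext fun w => ?_)
  have h1 : ((n : G) : G ⧸ N) = 1 := (QuotientGroup.eq_one_iff _).2 n.2
  have h2 : (inflSumInd N ρU ρV) n w = (w.1, Representation.ind N.subtype ρV n w.2) := by
    simp [inflSumInd, Representation.prod, h1]
  change symProj N ρV (symAction (inflSumInd N ρU ρV) n (ι F _ w)) =
    Algebra.TensorProduct.map (AlgHom.id F _) (symAction ρV n) (symProj N ρV (ι F _ w))
  rw [symAction_eq, symMap_ι, symProj_ι, symProj_ι, h2, indProj_ind]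
  simp [symAction_eq]

/-- Modulo the ideal generated by the positive degree invariants of `N` on `S(V)`, the image in
`S(U) ⊗ S(V)` of an invariant of `G` is determined by its component in `S(U)`. -/
theorem symProj_sub_mem [Fintype N] (hN : (Fintype.card N : F) ≠ 0)
    {x : SymmetricAlgebra F (U × Representation.IndV N.subtype ρV)}
    (hx : ∀ g, symAction (inflSumInd N ρU ρV) g x = x) :
    symProj N ρV x - symMap (LinearMap.fst F U (Representation.IndV N.subtype ρV)) x ⊗ₜ 1 ∈
      (hilbertIdeal ρV).map (Algebra.TensorProduct.includeRight :
        SymmetricAlgebra F V →ₐ[F] SymmetricAlgebra F U ⊗[F] SymmetricAlgebra F V).toRingHom := by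
  have h1 : symProj N ρV x = (reynolds ρV).lTensor (SymmetricAlgebra F U) (symProj N ρV x) := by
    have h2 : ∀ n : N, ((symAction ρV n).toLinearMap).lTensor (SymmetricAlgebra F U)
        (symProj N ρV x) = symProj N ρV x := fun n => by
      conv_rhs => rw [← hx n, symProj_symAction]
      rfl
    have h3 : (reynolds ρV).lTensor (SymmetricAlgebra F U) =
        (Fintype.card N : F)⁻¹ • ∑ n, ((symAction ρV n).toLinearMap).lTensor _ := by
      ext a b
      simp [reynolds, TensorProduct.tmul_sum]
    rw [h3, LinearMap.smul_apply, LinearMap.sum_apply, Finset.sum_congr rfl fun n _ => h2 n]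
    simp [← Nat.cast_smul_eq_nsmul F, smul_smul, hN]
  rw [← map_algebraMapInv_symProj]
  nth_rw 1 [h1]
  -- With the first occurrence replaced by its average, the claim holds for every tensor and is
  -- additive, so pure tensors suffice.
  induction symProj N ρV x using TensorProduct.induction_on with
  | zero => simp
  | add a b ha hb =>
    rw [map_add, map_add, add_sub_add_comm]
    exact add_mem ha hb
  | tmul a b =>
    have h4 : (reynolds ρV).lTensor (SymmetricAlgebra F U) (a ⊗ₜ b) -
        Algebra.TensorProduct.map (AlgHom.id F (SymmetricAlgebra F U))
          ((Algebra.ofId F (SymmetricAlgebra F V)).comp algebraMapInv) (a ⊗ₜ b) =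
        (a ⊗ₜ 1) * (1 ⊗ₜ (reynolds ρV b - algebraMap F _ (algebraMapInv (R := F) b))) := by
      rw [Algebra.TensorProduct.tmul_mul_tmul, mul_one, one_mul, TensorProduct.tmul_sub]
      rfl
    rw [h4]
    exact Ideal.mul_mem_left _ _
      (Ideal.mem_map_of_mem _ (reynolds_sub_mem_hilbertIdeal ρV hN b))

theorem add_le_bRep_inflSumInd [Fintype N] (hN : (Fintype.card N : F) ≠ 0) {r s d e : ℕ}
    {f : SymmetricAlgebra F U} (hf : f ∈ symGrading F U d) (hfr : f ∉ hilbertIdeal ρU ^ r)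
    {h : SymmetricAlgebra F V} (hh : h ∈ symGrading F V e) (hhs : h ∉ hilbertIdeal ρV ^ s) :
    ((d + e : ℕ) : ℕ∞) ≤ bRep (r + s - 1) (inflSumInd N ρU ρV) := by
  refine le_bRep (x := symMap (LinearMap.inl F U (Representation.IndV N.subtype ρV)) f *
    symMap (LinearMap.inr F U (Representation.IndV N.subtype ρV) ∘ₗ Representation.IndV.mk N.subtype ρV 1) h)
    (mul_mem_symGrading (symMap_mem_symGrading _ hf) (symMap_mem_symGrading _ hh)) fun hmem => ?_
  refine tmul_notMem_sup_pow (F := F) hfr hhs ?_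
  have h0 : symProj N ρV (symMap (LinearMap.inl F U (Representation.IndV N.subtype ρV)) f *
      symMap (LinearMap.inr F U (Representation.IndV N.subtype ρV) ∘ₗ Representation.IndV.mk N.subtype ρV 1) h) = f ⊗ₜ h := by
    rw [map_mul, symProj_symMap_inl, symProj_symMap_inr,
      Algebra.TensorProduct.tmul_mul_tmul, mul_one, one_mul]
  rw [← h0]
  have hmap := Ideal.mem_map_of_mem (symProj N ρV).toRingHom hmem
  rw [Ideal.map_pow] at hmap
  refine Ideal.pow_right_mono (map_hilbertIdeal_le _ fun m hm x hx hinv => ?_) _ hmap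
  have h3 : symMap (LinearMap.fst F U (Representation.IndV N.subtype ρV)) x ∈ hilbertIdeal ρU := by
    refine mem_hilbertIdeal hm (symMap_mem_symGrading _ hx) fun g => ?_
    -- `G` acts on `U` through `G ⧸ N`, so invariance under `G` suffices.
    obtain ⟨g, rfl⟩ := QuotientGroup.mk_surjective g
    have h := symMap_symAction (ρ := inflSumInd N ρU ρV)
      (ρ' := ρU.comp (QuotientGroup.mk' N)) (T := LinearMap.fst F U _) (g := g) (fun _ => rfl) x
    rw [hinv] at h
    exact h.symm
  rw [← sub_add_cancel (symProj N ρV x) (symMap (LinearMap.fst F U (Representation.IndV N.subtype ρV)) x ⊗ₜ 1)]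
  exact add_mem (Ideal.mem_sup_right (symProj_sub_mem N ρV ρU hN hinv))
    (Ideal.mem_sup_left (Ideal.mem_map_of_mem (Algebra.TensorProduct.includeLeft :
      SymmetricAlgebra F U →ₐ[F] SymmetricAlgebra F U ⊗[F] SymmetricAlgebra F V).toRingHom h3))

theorem bRep_add_bRep_le [Fintype N] (hN : (Fintype.card N : F) ≠ 0) {r s : ℕ}
    (hr : 0 < r) (hs : 0 < s) :
    bRep r ρU + bRep s ρV ≤ bRep (r + s - 1) (inflSumInd N ρU ρV) := by
  refine ENat.biSup_add_biSup_le' (exists_quotientGrading_ne_bot ρU hr)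
    (exists_quotientGrading_ne_bot ρV hs) fun d hd e he => ?_
  obtain ⟨f, hf, hfI⟩ := quotientGrading_ne_bot_iff.1 hd
  obtain ⟨h, hh, hhI⟩ := quotientGrading_ne_bot_iff.1 he
  rw [map_invariantsPos_pow] at hfI hhI
  exact_mod_cast add_le_bRep_inflSumInd N ρV ρU hN hf hfI hh hhI

end NormalSubgroup

end NoetherNumbers

namespace NoetherNumbers

open SymmetricAlgebra

/-! ### Polarization by the regular representation: `b_k(W) + 1 ≤ β_k(W ⊕ FG)` -/

section Regular

variable {F : Type*} [Field F] {G : Type*} [Group G] {W : Type*} [AddCommGroup W] [Module F W]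

/-- The direct sum of `W` and the regular representation of `G`. -/
noncomputable def sumRegular (ρ : Representation F G W) :
    Representation F G (W × MonoidAlgebra F G) :=
  ρ.prod (Representation.leftRegular F G)

theorem sumRegular_apply (ρ : Representation F G W) (g : G) (w : W × MonoidAlgebra F G) :
    sumRegular ρ g w = (ρ g w.1, Representation.leftRegular F G g w.2) :=
  rfl

/-- The invariant `∑ g, g(f) x_g` in `S(W ⊕ F G)`, where the `x_g` form the standard basis
of `F G`. -/
noncomputable def polarization [Fintype G] (ρ : Representation F G W)
    (f : SymmetricAlgebra F W) : SymmetricAlgebra F (W × MonoidAlgebra F G) :=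
  ∑ g, symMap (LinearMap.inl F W _) (symAction ρ g f) *
    ι F (W × MonoidAlgebra F G) (0, MonoidAlgebra.single g 1)

theorem symAction_polarization [Fintype G] (ρ : Representation F G W)
    (f : SymmetricAlgebra F W) (g : G) :
    symAction (sumRegular ρ) g (polarization ρ f) = polarization ρ f := by
  rw [polarization, map_sum]
  refine Fintype.sum_equiv (Equiv.mulLeft g) _ _ fun h => ?_
  rw [map_mul, ← symMap_symAction (ρ := ρ), ← symAction_mul, symAction_eq (sumRegular ρ), symMap_ι,
    sumRegular_apply]
  · simp
  · intro w
    simp [sumRegular_apply]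

theorem polarization_mem_symGrading [Fintype G] (ρ : Representation F G W) {d : ℕ}
    {f : SymmetricAlgebra F W} (hf : f ∈ symGrading F W d) :
    polarization ρ f ∈ symGrading F (W × MonoidAlgebra F G) (d + 1) :=
  sum_mem fun g _ => mul_mem_symGrading
    (symMap_mem_symGrading _ (symMap_mem_symGrading (ρ g) hf)) (ι_mem_symGrading _)

/-- The algebra homomorphism `S(W ⊕ F G) → A[ε]` which extends a homomorphism `S(W) → A` and sends
the basis element `x_1` of `F G` to `ε` and `x_g` to `0` for `g ≠ 1`. -/
noncomputable def toDualNumber (G : Type*) [Group G] {A : Type*} [CommRing A] [Algebra F A]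
    (φ : SymmetricAlgebra F W →ₐ[F] A) :
    SymmetricAlgebra F (W × MonoidAlgebra F G) →ₐ[F] TrivSqZeroExt A A :=
  SymmetricAlgebra.lift
    ((TrivSqZeroExt.inlAlgHom F A A).toLinearMap ∘ₗ φ.toLinearMap ∘ₗ ι F W ∘ₗ
        LinearMap.fst F W _ +
      (TrivSqZeroExt.inrHom A A).restrictScalars F ∘ₗ Algebra.linearMap F A ∘ₗ
        Finsupp.lapply 1 ∘ₗ (MonoidAlgebra.coeffLinearEquiv F).toLinearMap ∘ₗ
          LinearMap.snd F W _)

section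

variable {A : Type*} [CommRing A] [Algebra F A] (φ : SymmetricAlgebra F W →ₐ[F] A)

theorem toDualNumber_ι (w : W × MonoidAlgebra F G) :
    toDualNumber G φ (ι F _ w) = TrivSqZeroExt.inl (φ (ι F W w.1)) +
      TrivSqZeroExt.inr (algebraMap F A (w.2.coeff 1)) := by
  rw [toDualNumber, lift_ι_apply]
  rfl

theorem toDualNumber_symMap_inl (x : SymmetricAlgebra F W) :
    toDualNumber G φ (symMap (LinearMap.inl F W _) x) = TrivSqZeroExt.inl (φ x) := by
  suffices (toDualNumber G φ).comp (symMap (LinearMap.inl F W _)) =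
    (TrivSqZeroExt.inlAlgHom F A A).comp φ from DFunLike.congr_fun this x
  refine SymmetricAlgebra.algHom_ext (LinearMap.ext fun w => ?_)
  change toDualNumber G φ (symMap (LinearMap.inl F W _) (ι F W w)) =
    TrivSqZeroExt.inl (φ (ι F W w))
  rw [symMap_ι, toDualNumber_ι]
  simp

theorem fst_toDualNumber (x : SymmetricAlgebra F (W × MonoidAlgebra F G)) :
    (toDualNumber G φ x).fst = φ (symMap (LinearMap.fst F W _) x) := by
  suffices (TrivSqZeroExt.fstHom F A A).comp (toDualNumber G φ) =
    φ.comp (symMap (LinearMap.fst F W _)) from DFunLike.congr_fun this x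
  refine SymmetricAlgebra.algHom_ext (LinearMap.ext fun w => ?_)
  change (toDualNumber G φ (ι F _ w)).fst = φ (symMap (LinearMap.fst F W _) (ι F _ w))
  rw [symMap_ι, toDualNumber_ι]
  simp

theorem toDualNumber_polarization [Fintype G] (ρ : Representation F G W)
    (f : SymmetricAlgebra F W) :
    toDualNumber G φ (polarization ρ f) = TrivSqZeroExt.inr (φ f) := by
  classical
  rw [polarization, map_sum, Finset.sum_eq_single 1]
  · rw [map_mul, toDualNumber_symMap_inl, toDualNumber_ι, symAction_eq, map_one]
    change TrivSqZeroExt.inl (φ (symMap LinearMap.id f)) * _ = _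
    rw [symMap_id]
    ext <;> simp
  · intro g _ hg
    rw [map_mul, toDualNumber_ι]
    simp [hg]
  · simp

/-- In `A[ε]`, positive degree invariants land in the sum of `(ε)` and the ideal generated by the
image of `hilbertIdeal ρ`, while the polarization becomes `ε φ(f) ≠ 0`. -/
theorem polarization_notMem_of_ne_zero [Fintype G] {ρ : Representation F G W} {k : ℕ}
    (hφ : (hilbertIdeal ρ).map φ.toRingHom ^ k = ⊥) {f : SymmetricAlgebra F W} (hf : φ f ≠ 0) :
    polarization ρ f ∉ hilbertIdeal (sumRegular ρ) ^ (k + 1) := by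
  intro hmem
  let I : Ideal (TrivSqZeroExt A A) :=
    ((hilbertIdeal ρ).map φ.toRingHom).map (TrivSqZeroExt.inlHom A A)
  have hI : I ^ k = ⊥ := by
    rw [← Ideal.map_pow, hφ, Ideal.map_bot]
  have h0 := eq_zero_of_mem_hilbertIdeal_pow (toDualNumber G φ)
    (K := I ⊔ TrivSqZeroExt.kerIdeal A A)
    -- Since `ε² = 0`, the exponents are `k` and `2`, and `k + 2 - 1 = k + 1`.
    (sup_pow_eq_bot hI (TrivSqZeroExt.kerIdeal_sq A A)) (fun d hd x hx hinv => ?_) hmem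
  · rw [toDualNumber_polarization] at h0
    exact hf (TrivSqZeroExt.inr_injective h0)
  · have h1 : symMap (LinearMap.fst F W _) x ∈ hilbertIdeal ρ := by
      refine mem_hilbertIdeal hd (symMap_mem_symGrading _ hx) fun g => ?_
      rw [← symMap_symAction (ρ := sumRegular ρ) (ρ' := ρ) fun _ => rfl, hinv]
    rw [← TrivSqZeroExt.inl_fst_add_inr_snd_eq (toDualNumber G φ x), fst_toDualNumber]
    exact add_mem (Ideal.mem_sup_left (Ideal.mem_map_of_mem (TrivSqZeroExt.inlHom A A)
      (Ideal.mem_map_of_mem φ.toRingHom h1)))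
      (Ideal.mem_sup_right ((TrivSqZeroExt.mem_kerIdeal_iff_inr _ _ _).2 rfl))

end

theorem polarization_notMem [Fintype G] {ρ : Representation F G W} {k : ℕ}
    {f : SymmetricAlgebra F W} (hf : f ∉ hilbertIdeal ρ ^ k) :
    polarization ρ f ∉ hilbertIdeal (sumRegular ρ) ^ (k + 1) := by
  refine polarization_notMem_of_ne_zero (Ideal.Quotient.mkₐ F (hilbertIdeal ρ ^ k)) ?_
    fun h => hf (Ideal.Quotient.eq_zero_iff_mem.1 h)
  rw [← Ideal.map_pow]
  exact Ideal.map_quotient_self _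

theorem bRep_add_one_le_betaRep_sumRegular [Fintype G] (ρ : Representation F G W) {k : ℕ}
    (hk : 0 < k) : bRep k ρ + 1 ≤ betaRep k (sumRegular ρ) := by
  rw [bRep, topDeg, ENat.biSup_add' (exists_quotientGrading_ne_bot ρ hk)]
  refine iSup₂_le fun d hd => ?_
  obtain ⟨f, hf, hfI⟩ := quotientGrading_ne_bot_iff.1 hd
  rw [map_invariantsPos_pow] at hfI
  rw [← Nat.cast_succ]
  refine le_betaRep (x := ⟨polarization ρ f, fun g => symAction_polarization ρ f g⟩)
    (polarization_mem_symGrading ρ hf) fun hmem => polarization_notMem hfI ?_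
  have := Ideal.mem_map_of_mem (invariants (sumRegular ρ)).val.toRingHom hmem
  rwa [map_invariantsPos_pow] at this

end Regular

/-! ### Suprema over all modules -/

section NoetherNumber

variable {F : Type*} [Field F] {G : Type*} [Group G]
  {W : Type*} [AddCommGroup W] [Module F W] {W' : Type*} [AddCommGroup W'] [Module F W']

/-- The homomorphism of algebras of invariants induced by an equivariant linear map. -/
noncomputable def invariantsMap {ρ : Representation F G W} {ρ' : Representation F G W'}
    (T : W →ₗ[F] W') (hT : ∀ g w, T (ρ g w) = ρ' g (T w)) : invariants ρ →ₐ[F] invariants ρ' :=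
  ((symMap T).comp (invariants ρ).val).codRestrict _ fun x g => by
    change symAction ρ' g (symMap T x) = symMap T x
    rw [← symMap_symAction (hT g), x.2 g]

theorem map_invariantsPos_le {ρ : Representation F G W} {ρ' : Representation F G W'}
    (T : W →ₗ[F] W') (hT : ∀ g w, T (ρ g w) = ρ' g (T w)) :
    (invariantsPos ρ).map (invariantsMap T hT).toRingHom ≤ invariantsPos ρ' := by
  rw [invariantsPos, positivePart, Ideal.map_span, Ideal.span_le]
  rintro _ ⟨x, ⟨d, hd, hx⟩, rfl⟩
  exact mem_invariantsPos hd (symMap_mem_symGrading T hx)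

theorem betaRep_le_of_equiv {ρ : Representation F G W} {ρ' : Representation F G W'}
    (e : W ≃ₗ[F] W') (he : ∀ g w, e (ρ g w) = ρ' g (e w)) (k : ℕ) :
    betaRep k ρ ≤ betaRep k ρ' := by
  refine iSup₂_le fun d hd => ?_
  obtain ⟨f, hf, hfI⟩ := quotientGrading_ne_bot_iff.1 hd
  have he' : ∀ g w, e.symm (ρ' g w) = ρ g (e.symm w) := fun g w => by
    rw [LinearEquiv.symm_apply_eq, he, LinearEquiv.apply_symm_apply]
  refine le_betaRep (x := invariantsMap e.toLinearMap he f) (symMap_mem_symGrading _ hf)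
    fun hmem => hfI ?_
  have h1 := Ideal.mem_map_of_mem (invariantsMap e.symm.toLinearMap he').toRingHom hmem
  rw [Ideal.map_pow] at h1
  have h2 := Ideal.pow_right_mono (map_invariantsPos_le e.symm.toLinearMap he') _ h1
  convert h2
  refine Subtype.ext ?_
  change (f : SymmetricAlgebra F W) = symMap e.symm.toLinearMap (symMap e.toLinearMap f)
  rw [symMap_symMap]
  simp [symMap_id]

/-- Choosing a basis transports the action to `Fin n → F`, so `W` may live in any universe; this is
needed for induced modules, whose universe also depends on `G`. -/
theorem betaRep_le_noetherNumber [FiniteDimensional F W] (ρ : Representation F G W) (k : ℕ) :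
    betaRep k ρ ≤ noetherNumber k F G := by
  let e : W ≃ₗ[F] (Fin (Module.finrank F W) → F) := (Module.finBasis F W).equivFun
  let ρ' : Representation F G (Fin (Module.finrank F W) → F) :=
    { toFun := fun g => e.conj (ρ g)
      map_one' := by rw [map_one]; exact e.conj_id
      map_mul' := fun g h => by rw [map_mul]; exact LinearEquiv.conj_comp e _ _ }
  refine (betaRep_le_of_equiv (ρ' := ρ') e (fun g w => ?_) k).trans ?_
  · simp [ρ', LinearEquiv.conj_apply]
  · rw [noetherNumber]
    exact le_iSup_of_le (Fin (Module.finrank F W) → F) <| le_iSup_of_le _ <| le_iSup_of_le _ <|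
      le_iSup_of_le inferInstance <| le_iSup_of_le ρ' le_rfl

universe u

theorem add_noetherNumber_le {F : Type u} [Field F] {k : ℕ} {a c : ℕ∞}
    (h : ∀ (W : Type u) [AddCommGroup W] [Module F W] [FiniteDimensional F W]
      (ρ : Representation F G W), a + betaRep k ρ ≤ c) : a + noetherNumber k F G ≤ c := by
  -- Subtracting `a` requires it to be finite; if `a = ⊤`, the zero module alone already forces `c =
  -- ⊤`.
  rcases eq_or_ne a ⊤ with rfl | ha
  · exact le_self_add.trans (h PUnit 1)
  calc a + noetherNumber k F G ≤ a + (c - a) := by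
        gcongr
        exact iSup_le fun W => iSup_le fun _ => iSup_le fun _ => iSup_le fun _ =>
          iSup_le fun ρ => ENat.le_sub_of_add_le_left ha (h W ρ)
    _ = c := add_tsub_cancel_of_le (le_self_add.trans (h PUnit 1))

theorem noetherNumber_add_noetherNumber_le {F : Type u} [Field F] {H : Type*} [Group H] {r s : ℕ}
    {c : ℕ∞} (h : ∀ (W : Type u) [AddCommGroup W] [Module F W] [FiniteDimensional F W]
      (W' : Type u) [AddCommGroup W'] [Module F W'] [FiniteDimensional F W']
      (ρ : Representation F G W) (ρ' : Representation F H W'), betaRep r ρ + betaRep s ρ' ≤ c) :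
    noetherNumber r F G + noetherNumber s F H ≤ c := by
  refine add_noetherNumber_le fun W' _ _ _ ρ' => ?_
  rw [add_comm]
  refine add_noetherNumber_le fun W _ _ _ ρ => ?_
  rw [add_comm]
  exact h W W' ρ ρ'

end NoetherNumber

end NoetherNumbers

theorem theorem4p2 {F : Type*} [Field F] {G : Type*} [Group G] [Finite G]
    (hchar : ¬ ringChar F ∣ Nat.card G) (N : Subgroup G) [N.Normal]
    (r s : ℕ) (hr : 0 < r) (hs : 0 < s) :
    (∀ (U : Type*) [AddCommGroup U] [Module F U] [FiniteDimensional F U]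
        (V : Type*) [AddCommGroup V] [Module F V] [FiniteDimensional F V]
        (ρU : Representation F (G ⧸ N) U) (ρV : Representation F N V),
      NoetherNumbers.bRep r ρU + NoetherNumbers.bRep s ρV ≤
        NoetherNumbers.bRep (r + s - 1) (NoetherNumbers.inflSumInd N ρU ρV)) ∧
    NoetherNumbers.noetherNumber r F (G ⧸ N) + NoetherNumbers.noetherNumber s F N ≤
      NoetherNumbers.noetherNumber (r + s - 1) F G + 1 := by
  have := Fintype.ofFinite G
  have := Fintype.ofFinite N
  have := Fintype.ofFinite (G ⧸ N)
  have hcard : ∀ m : ℕ, m ∣ Nat.card G → (m : F) ≠ 0 := fun m hm h =>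
    hchar (((ringChar.spec F m).1 h).trans hm)
  have hN : (Fintype.card N : F) ≠ 0 :=
    hcard _ (Nat.card_eq_fintype_card (α := N) ▸ N.card_subgroup_dvd_card)
  have hQ : (Fintype.card (G ⧸ N) : F) ≠ 0 :=
    hcard _ (Nat.card_eq_fintype_card (α := G ⧸ N) ▸ N.card_quotient_dvd_card)
  refine ⟨fun U _ _ _ V _ _ _ ρU ρV =>
    NoetherNumbers.bRep_add_bRep_le N ρV ρU hN hr hs, ?_⟩
  refine NoetherNumbers.noetherNumber_add_noetherNumber_le fun U _ _ _ V _ _ _ ρU ρV => ?_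
  have : FiniteDimensional F (Representation.IndV N.subtype ρV) :=
    Module.Finite.of_surjective _ (Representation.Coinvariants.mk_surjective _)
  -- Passing from `β` to `b` costs one for each of `U` and `V`; adding the regular representation
  -- wins one back.
  calc NoetherNumbers.betaRep r ρU + NoetherNumbers.betaRep s ρV
      ≤ (NoetherNumbers.bRep r ρU + 1) + (NoetherNumbers.bRep s ρV + 1) :=
        add_le_add (NoetherNumbers.betaRep_le_bRep_add_one ρU hQ r)
          (NoetherNumbers.betaRep_le_bRep_add_one ρV hN s)
    _ = (NoetherNumbers.bRep r ρU + NoetherNumbers.bRep s ρV) + 1 + 1 := by ring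
    _ ≤ NoetherNumbers.bRep (r + s - 1) (NoetherNumbers.inflSumInd N ρU ρV) + 1 + 1 := by
        gcongr
        exact NoetherNumbers.bRep_add_bRep_le N ρV ρU hN hr hs
    _ ≤ NoetherNumbers.betaRep (r + s - 1)
          (NoetherNumbers.sumRegular (NoetherNumbers.inflSumInd N ρU ρV)) + 1 := by
        gcongr
        exact NoetherNumbers.bRep_add_one_le_betaRep_sumRegular _ (by omega)
    _ ≤ NoetherNumbers.noetherNumber (r + s - 1) F G + 1 := by
        gcongr
        exact NoetherNumbers.betaRep_le_noetherNumber _ _
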